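/- A 3-uniform hypergraph $H$ consists of a finite vertex set $V(H)$ and a set $E(H)$ of 3-element subsets of $V(H)$, called edges. Let $\delta_1(H)$ denote the minimum, over all vertices $v\in V(H)$, of the number of edges of $H$ containing $v$. A $d$-matching in H is a set of $d$ pairwise disjoint edges of $H$. Given disjoint sets $V,W$ with $|V\cup W|=n$ and $|W|=d$, let $H_{n,d}(V,W)$ be the 3-uniform hypergraph on the vertex set $V\cup W$ whose edges are all 3-element subsets of $V\cup W$ that meet both $V$ and $W$ (that is, those with two vertices in $V$ and one in $W$, or one in $V$ and two in $W$). For $\varepsilon>0$, a 3-uniform hypergraph $H$ on $n$ vertices is called $\varepsilon$-close to $H_{n,d}$ if there is a partition $V,W$ of $V(H)$ with $|W|=d$ such that $$|E(H_{n,d}(V,W))\setminus E(H)|\le \varepsilon n^3 .$$ **Lemma 4.1.** There exist $\varepsilon>0$ and $n_0\in\mathbb N$ such that the following holds. Suppose that $H$ is a 3-uniform hypergraph on $n\ge n_0$ vertices and that $d\ge 0$ is an integer with $d\le n/3$. If $$\delta_1(H)>\binom{n-1}{2}-\binom{n-d}{2}$$ and $H$ is $\varepsilon$-close to $H_{n,d}$,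 then $H$ contains a $d$-matching. -/

import Mathlib

namespace Hypergraph

/-- Every edge of `H` has exactly three vertices. -/
def IsThreeUniform {α : Type*} (H : Hypergraph α) : Prop :=
  ∀ e ∈ H.edgeSet, e.ncard = 3

/-- The number of edges of a (finite) hypergraph that contain the vertex `v`. -/
noncomputable def vertexDegree {α : Type*} (H : Hypergraph α) (v : α) : ℕ :=
  {e | e ∈ H.edgeSet ∧ v ∈ e}.ncard

/-- The minimum vertex degree `δ₁(H)` of a finite hypergraph with at least one vertex. -/
noncomputable def minVertexDegree {α : Type*} (H : Hypergraph α) : ℕ :=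
  sInf (H.vertexDegree '' H.vertexSet)

/-- `e` is a triple `{x, y, z}` of distinct vertices with `x ∈ A`, `y ∈ B`, `z ∈ C`. -/
def IsTripleOfType {α : Type*} (A B C : Set α) (e : Set α) : Prop :=
  ∃ x ∈ A, ∃ y ∈ B, ∃ z ∈ C, x ≠ y ∧ x ≠ z ∧ y ≠ z ∧ e = {x, y, z}

/-- The hypergraph `H_{n,d}(V, W)`, where `n = |V ∪ W|` and `d = |W|`: its vertex set is `V ∪ W`
and its edges are all triples of type `VVW` or `VWW`. -/
def extremal {α : Type*} (V W : Set α) : Hypergraph α where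
  vertexSet := V ∪ W
  edgeSet := {e | IsTripleOfType V V W e ∨ IsTripleOfType V W W e}
  subset_vertexSet_of_mem_edgeSet' := by
    rintro e (⟨x, hx, y, hy, z, hz, -, -, -, rfl⟩ | ⟨x, hx, y, hy, z, hz, -, -, -, rfl⟩) <;>
    · rintro w (rfl | rfl | rfl) <;> simp_all

/-- `H` is `ε`-close to `H_{n,d}(V, W)`: at most `ε n³` edges of `H_{n,d}(V, W)` are missing
from `H`, where `n` is the number of vertices of `H`. -/
def IsCloseToExtremalOn {α : Type*} (H : Hypergraph α) (ε : ℝ) (V W : Set α) : Prop :=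
  (((extremal V W).edgeSet \ H.edgeSet).ncard : ℝ) ≤ ε * (H.vertexSet.ncard : ℝ) ^ 3

/-- `H` is `ε`-close to `H_{n,d}`: there is a partition `V, W` of the vertex set of `H` with
`|W| = d` such that `H` is `ε`-close to `H_{n,d}(V, W)`. A part may be empty. -/
def IsCloseToExtremal {α : Type*} (H : Hypergraph α) (ε : ℝ) (d : ℕ) : Prop :=
  ∃ V W : Set α, V ∪ W = H.vertexSet ∧ Disjoint V W ∧ W.ncard = d ∧
    H.IsCloseToExtremalOn ε V W

/-- `M` is a matching in `H`: a set of pairwise vertex-disjoint edges of `H`. -/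
def IsMatching {α : Type*} (H : Hypergraph α) (M : Set (Set α)) : Prop :=
  M ⊆ H.edgeSet ∧ ∀ e ∈ M, ∀ f ∈ M, e ≠ f → Disjoint e f

/-- `H` contains a `d`-matching, that is, a matching consisting of exactly `d` edges. -/
def HasMatchingOfSize {α : Type*} (H : Hypergraph α) (d : ℕ) : Prop :=
  ∃ M : Set (Set α), H.IsMatching M ∧ M.encard = d

end Hypergraph

/-!
If `d` is small compared to `n`, the degree condition alone yields the matching, by the
Bollobás–Daykin–Erdős induction on `d`: if there is no `d`-matching although deleting any vertex
leaves a `(d - 1)`-matching, then every edge meets each of these matchings, which forces a vertex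
of degree `O(d²)`.

Otherwise, call a vertex atypical if it lies in many triples that meet both `V` and `W` but are not
edges. By closeness there are few atypical vertices. A matching of at most twice as many edges
covers them and contains, on average, at most one vertex of `W` per edge, so enough of `W`
survives. All remaining vertices are typical. A few edges of type `VWW` correct the
shortage of vertices in `V`, after which a perfect matching of triples of type `VVW` is a
three-dimensional matching problem: in an assignment with the most correct triples, a wrong triple
could be repaired by rotating partners with two other triples.
-/

namespace TripleSystem

open Finset

variable {α : Type*} {F 𝒜 ℬ M N : Finset (Finset α)} {X Y e : Finset α} {v : α}
  {H : Hypergraph α}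

/-- `M` is a matching of triples from `F`, all of them contained in `X`. -/
structure IsTripleMatching (F : Finset (Finset α)) (X : Finset α) (M : Finset (Finset α)) :
    Prop where
  subset : M ⊆ F
  subset_powersetCard : M ⊆ X.powersetCard 3
  pairwiseDisjoint : (M : Set (Finset α)).PairwiseDisjoint id

namespace IsTripleMatching

protected theorem empty (F : Finset (Finset α)) (X : Finset α) : IsTripleMatching F X ∅ :=
  ⟨empty_subset _, empty_subset _, by simp⟩

protected theorem singleton (he : e ∈ F) (hc : #e = 3) : IsTripleMatching F e {e} :=
  ⟨by simpa, by simpa, by simp⟩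

protected theorem mono (hM : IsTripleMatching F X M) (hXY : X ⊆ Y) : IsTripleMatching F Y M :=
  ⟨hM.subset, hM.subset_powersetCard.trans (powersetCard_mono hXY), hM.pairwiseDisjoint⟩

theorem card_eq (hM : IsTripleMatching F X M) (he : e ∈ M) : #e = 3 :=
  (mem_powersetCard.1 (hM.subset_powersetCard he)).2

theorem exists_card_eq_fintypeCard {ι : Type*} [Fintype ι] {t : ι → Finset α}
    (hF : ∀ k, t k ∈ F) (hX : ∀ k, t k ∈ X.powersetCard 3)
    (hd : Pairwise fun k l => Disjoint (t k) (t l)) :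
    ∃ M, IsTripleMatching F X M ∧ #M = Fintype.card ι := by
  have hinj : Function.Injective t := fun k l hkl => by
    by_contra hne
    have hdkl : Disjoint (t k) (t l) := hd hne
    rw [← hkl, disjoint_self_iff_empty] at hdkl
    simpa [hdkl] using hX k
  refine ⟨univ.map ⟨t, hinj⟩, ⟨?_, ?_, ?_⟩, card_map _⟩
  · simpa [subset_iff] using hF
  · simpa [subset_iff] using hX
  · rw [coe_map, coe_univ, Set.image_univ]
    rintro _ ⟨k, rfl⟩ _ ⟨l, rfl⟩ hne
    exact hd fun h => hne (congrArg t h)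

end IsTripleMatching

open scoped Classical in
/-- The edges of `H` among the triples of vertices in `X`, as finite sets. -/
noncomputable def edgeTriples (H : Hypergraph α) (X : Finset α) : Finset (Finset α) :=
  {e ∈ X.powersetCard 3 | (e : Set α) ∈ H.edgeSet}

theorem mem_edgeTriples :
    e ∈ edgeTriples H X ↔ e ∈ X.powersetCard 3 ∧ (e : Set α) ∈ H.edgeSet := by
  classical
  exact mem_filter

theorem edgeTriples_subset : edgeTriples H X ⊆ X.powersetCard 3 :=
  fun _ he => (mem_edgeTriples.1 he).1

theorem IsTripleMatching.hasMatchingOfSize (hM : IsTripleMatching (edgeTriples H X) Y M) :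
    H.HasMatchingOfSize #M := by
  refine ⟨(fun e : Finset α => (e : Set α)) '' M, ⟨?_, ?_⟩, ?_⟩
  · rintro _ ⟨e, he, rfl⟩
    exact (mem_edgeTriples.1 (hM.subset he)).2
  · rintro _ ⟨e, he, rfl⟩ _ ⟨f, hf, rfl⟩ hne
    exact disjoint_coe.2 (hM.pairwiseDisjoint he hf (ne_of_apply_ne _ hne))
  · rw [coe_injective.encard_image, Set.encard_coe_eq_coe_finsetCard]

variable [DecidableEq α] {V W : Finset α}

/-- The number of members of the set family `𝒜` that contain `v`. -/
def degree (𝒜 : Finset (Finset α)) (v : α) : ℕ := #{e ∈ 𝒜 | v ∈ e}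

theorem degree_mono (h : 𝒜 ⊆ ℬ) (v : α) : degree 𝒜 v ≤ degree ℬ v :=
  card_le_card (filter_subset_filter _ h)

theorem degree_inter_add_degree_sdiff (𝒜 ℬ : Finset (Finset α)) (v : α) :
    degree (𝒜 ∩ ℬ) v + degree (𝒜 \ ℬ) v = degree 𝒜 v := by
  rw [degree, degree, ← card_union_of_disjoint
    (disjoint_filter_filter (disjoint_sdiff_inter 𝒜 ℬ).symm), ← filter_union, union_comm,
    sdiff_union_inter, degree]

theorem degree_powersetCard (hv : v ∈ X) (k : ℕ) :
    degree (X.powersetCard (k + 1)) v = (#X - 1).choose k := by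
  simpa [degree] using card_filter_powersetCard_subset {v} X (k + 1) (by simpa) (by simp)

theorem card_mul_le_mul_card_of_le_degree {k K : ℕ} {B : Finset α}
    (h𝒜 : (𝒜 : Set (Finset α)).Sized k) (hB : ∀ v ∈ B, K ≤ degree 𝒜 v) :
    #B * K ≤ k * #𝒜 :=
  calc #B * K ≤ ∑ e ∈ 𝒜, #(B ∩ e) := le_sum_card_inter hB
    _ ≤ #𝒜 * k := sum_le_card_nsmul _ _ _ fun _ he =>
        (card_le_card inter_subset_right).trans (h𝒜 he).le
    _ = k * #𝒜 := mul_comm _ _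

theorem card_le_card_mul_of_not_disjoint {T : Finset α} {k : ℕ}
    (hT : ∀ e ∈ 𝒜, ¬Disjoint T e) (hk : ∀ t ∈ T, degree 𝒜 t ≤ k) : #𝒜 ≤ #T * k :=
  calc #𝒜 = ∑ _ ∈ 𝒜, 1 := card_eq_sum_ones 𝒜
    _ ≤ ∑ e ∈ 𝒜, #(T ∩ e) := sum_le_sum fun e he =>
        card_pos.2 (not_disjoint_iff_nonempty_inter.1 (hT e he))
    _ ≤ #T * k := sum_card_inter_le hk

theorem card_filter_notMem_le_degree_sdiff {β : Type*} {P : Finset β} {f : β → Finset α}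
    (hf : Set.InjOn f P) (h𝒜 : ∀ p ∈ P, f p ∈ 𝒜) (hv : ∀ p ∈ P, v ∈ f p) :
    #{p ∈ P | f p ∉ F} ≤ degree (𝒜 \ F) v := by
  refine card_le_card_of_injOn f (fun p hp => ?_) (hf.mono (filter_subset _ _))
  obtain ⟨hpP, hpF⟩ := mem_filter.1 hp
  exact mem_filter.2 ⟨mem_sdiff.2 ⟨h𝒜 p hpP, hpF⟩, hv p hpP⟩

theorem exists_insert_mem_of_degree_sdiff_lt {P : Finset (Finset α)} (hv : ∀ p ∈ P, v ∉ p)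
    (h𝒜 : ∀ p ∈ P, insert v p ∈ 𝒜) (hP : degree (𝒜 \ F) v < #P) : ∃ p ∈ P, insert v p ∈ F := by
  by_contra! hF
  have hle := card_filter_notMem_le_degree_sdiff (F := F) (v := v)
    (fun p hp q hq hpq => by
      rw [← erase_insert (hv p hp), hpq, erase_insert (hv q hq)]) h𝒜
    fun p _ => mem_insert_self v p
  rw [filter_true_of_mem hF] at hle
  exact hP.not_ge hle

theorem card_insert_of_disjoint_biUnion (he : e ∈ X.powersetCard 3)
    (hd : Disjoint (M.biUnion id) e) : #(insert e M) = #M + 1 := by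
  refine card_insert_of_notMem fun heM => ?_
  have hee := hd.mono_left (subset_biUnion_of_mem id heM)
  simp [(disjoint_self_iff_empty e).1 hee] at he

namespace IsTripleMatching

protected theorem biUnion_subset (hM : IsTripleMatching F X M) : M.biUnion id ⊆ X :=
  Finset.biUnion_subset.2 fun _ he => (mem_powersetCard.1 (hM.subset_powersetCard he)).1

theorem card_biUnion_inter {c : ℕ} (hM : IsTripleMatching F X M) (hc : ∀ e ∈ M, #(e ∩ Y) = c) :
    #(M.biUnion id ∩ Y) = c * #M := by
  rw [biUnion_inter, card_biUnion fun e he f hf hne =>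
      (hM.pairwiseDisjoint he hf hne).mono inter_subset_left inter_subset_left]
  exact (sum_const_nat hc).trans (mul_comm _ _)

protected theorem card_biUnion (hM : IsTripleMatching F X M) : #(M.biUnion id) = 3 * #M := by
  rw [← inter_eq_left.2 hM.biUnion_subset]
  refine hM.card_biUnion_inter fun e he => ?_
  rw [inter_eq_left.2 (mem_powersetCard.1 (hM.subset_powersetCard he)).1, hM.card_eq he]

protected theorem union (hM : IsTripleMatching F X M) (hN : IsTripleMatching F Y N)
    (hd : Disjoint (M.biUnion id) Y) : IsTripleMatching F (X ∪ Y) (M ∪ N) where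
  subset := union_subset hM.subset hN.subset
  subset_powersetCard :=
    union_subset (hM.mono subset_union_left).subset_powersetCard
      (hN.mono subset_union_right).subset_powersetCard
  pairwiseDisjoint := by
    rw [coe_union, Set.pairwiseDisjoint_union]
    exact ⟨hM.pairwiseDisjoint, hN.pairwiseDisjoint, fun e he f hf _ =>
      hd.mono (subset_biUnion_of_mem id he) (mem_powersetCard.1 (hN.subset_powersetCard hf)).1⟩

protected theorem card_union (hN : IsTripleMatching F Y N) (hd : Disjoint (M.biUnion id) Y) :
    #(M ∪ N) = #M + #N := by
  refine card_union_of_disjoint (disjoint_left.2 fun e heM heN => ?_)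
  have hee : Disjoint e e :=
    hd.mono (subset_biUnion_of_mem id heM) (mem_powersetCard.1 (hN.subset_powersetCard heN)).1
  simpa [(disjoint_self_iff_empty e).1 hee] using hN.card_eq heN

protected theorem insert (hM : IsTripleMatching F X M) (he : e ∈ F) (heX : e ∈ X.powersetCard 3)
    (hd : Disjoint (M.biUnion id) e) : IsTripleMatching F X (insert e M) := by
  obtain ⟨heX, he3⟩ := mem_powersetCard.1 heX
  rw [insert_eq, Finset.union_comm]
  exact (hM.union (.singleton he he3) hd).mono (union_subset Subset.rfl heX)

theorem exists_card_eq_add {k : ℕ} (hM : IsTripleMatching F X M)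
    (hN : ∃ N, IsTripleMatching F (X \ M.biUnion id) N ∧ #N = k) :
    ∃ N, IsTripleMatching F X N ∧ #N = #M + k := by
  obtain ⟨N, hN, rfl⟩ := hN
  exact ⟨M ∪ N, (hM.union hN disjoint_sdiff).mono (union_subset Subset.rfl sdiff_subset),
    hN.card_union disjoint_sdiff⟩

theorem not_disjoint_of_maximal (hM : IsTripleMatching F X M)
    (hmax : ∀ N, IsTripleMatching F X N → #N ≠ #M + 1) (he : e ∈ X.powersetCard 3 ∩ F) :
    ¬Disjoint (M.biUnion id) e := by
  obtain ⟨heX, heF⟩ := mem_inter.1 he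
  exact fun hd => hmax _ (hM.insert heF heX hd) (card_insert_of_disjoint_biUnion heX hd)

theorem degree_le_of_maximal (hM : IsTripleMatching F (X.erase v) M) (hv : v ∈ X)
    (hmax : ∀ N, IsTripleMatching F X N → #N ≠ #M + 1) :
    degree (X.powersetCard 3 ∩ F) v ≤ 3 * #M * #X := by
  have hMX := hM.mono (erase_subset v X)
  rw [← hM.card_biUnion]
  refine card_le_card_mul_of_not_disjoint
    (fun e he => hMX.not_disjoint_of_maximal hmax (mem_filter.1 he).1) fun t ht => ?_
  have htX := mem_erase.1 (hM.biUnion_subset ht)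
  have hcodeg := card_filter_powersetCard_subset {v, t} X 3
    (by simp [insert_subset_iff, hv, htX.2]) (card_le_two.trans (by norm_num))
  rw [card_pair htX.1.symm, Nat.choose_one_right] at hcodeg
  refine (card_le_card fun e he => ?_).trans (hcodeg.trans_le (Nat.sub_le _ _))
  simp only [mem_filter, mem_inter] at he
  simp only [mem_filter, insert_subset_iff, singleton_subset_iff]
  exact ⟨he.1.1.1, he.1.2, he.2⟩

end IsTripleMatching

/-! ### Small matchings -/

theorem exists_degree_le_of_no_matching {d : ℕ} (hX : X.Nonempty)
    (herase : ∀ v ∈ X, ∃ M, IsTripleMatching F (X.erase v) M ∧ #M = d)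
    (hmax : ∀ N, IsTripleMatching F X N → #N ≠ d + 1) :
    ∃ v ∈ X, degree (X.powersetCard 3 ∩ F) v ≤ 27 * d ^ 2 := by
  by_contra! hdeg
  have hupper : ∀ v ∈ X, degree (X.powersetCard 3 ∩ F) v ≤ 3 * d * #X := fun v hv => by
    obtain ⟨M, hM, rfl⟩ := herase v hv
    exact hM.degree_le_of_maximal hv hmax
  obtain ⟨v₀, hv₀⟩ := hX
  obtain ⟨M, hM, rfl⟩ := herase v₀ hv₀
  have hMX := hM.mono (erase_subset v₀ X)
  have hedges : #(X.powersetCard 3 ∩ F) ≤ 3 * #M * (3 * #M * #X) := by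
    rw [← hM.card_biUnion]
    refine card_le_card_mul_of_not_disjoint (fun e he => hMX.not_disjoint_of_maximal hmax he)
      fun t ht => ?_
    rw [hM.card_biUnion]
    exact hupper t (hMX.biUnion_subset ht)
  have hlower : #X * (27 * #M ^ 2 + 1) ≤ 3 * #(X.powersetCard 3 ∩ F) :=
    card_mul_le_mul_card_of_le_degree
      (fun e he => (mem_powersetCard.1 (mem_inter.1 he).1).2) hdeg
  have := card_pos.2 ⟨v₀, hv₀⟩
  nlinarith

theorem choose_two_add (p d : ℕ) :
    (p + d).choose 2 = p.choose 2 + p * d + d.choose 2 := by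
  qify
  simp only [Nat.cast_choose_two, Nat.cast_add]
  ring

/-- The Bollobás–Daykin–Erdős theorem for triples. -/
theorem exists_matching_of_degree_sdiff_lt (F : Finset (Finset α)) (d : ℕ) :
    ∀ X : Finset α, 100 * d ≤ #X →
      (∀ v ∈ X, degree (X.powersetCard 3 \ F) v < (#X - d).choose 2) →
      ∃ M, IsTripleMatching F X M ∧ #M = d := by
  induction d with
  | zero => exact fun X _ _ => ⟨∅, .empty F X, rfl⟩
  | succ d ih =>
    intro X hX hdeg
    by_contra! hmax
    have herase : ∀ v ∈ X, ∃ M, IsTripleMatching F (X.erase v) M ∧ #M = d := by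
      intro v hv
      refine ih (X.erase v) (by rw [card_erase_of_mem hv]; omega) fun u hu => ?_
      rw [card_erase_of_mem hv, Nat.sub_sub, add_comm 1 d]
      exact (degree_mono (sdiff_subset_sdiff (powersetCard_mono (erase_subset v X)) Subset.rfl)
        u).trans_lt (hdeg u (mem_of_mem_erase hu))
    obtain ⟨v, hv, hle⟩ := exists_degree_le_of_no_matching (card_pos.1 (by omega)) herase hmax
    have hsum := degree_inter_add_degree_sdiff (X.powersetCard 3) F v
    rw [degree_powersetCard hv] at hsum
    obtain ⟨p, hp⟩ : ∃ p, #X = p + d + 1 := ⟨#X - d - 1, by omega⟩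
    have hlt := hdeg v hv
    rw [hp, Nat.add_sub_cancel, choose_two_add] at hsum
    rw [hp, add_assoc, Nat.add_sub_cancel] at hlt
    have : 27 * d ≤ p := by omega
    nlinarith

/-! ### Three-dimensional matchings -/

section ThreeDimensional

variable {ι κ μ : Type*} {K : ℕ}

/-- Rotating the partners of `z`, `i` and `j` cyclically repairs the triple at `z`. -/
theorem exists_equiv_rel_insert {P : ι → κ → μ → Prop} (σ : ι ≃ κ) (τ : ι ≃ μ) {z i j : ι}
    (hi : i ≠ z) (hj : j ≠ z) (hij : i ≠ j) (hz : P z (σ i) (τ j)) (hPj : P j (σ z) (τ i))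
    (hPi : P i (σ j) (τ z)) :
    ∃ (σ' : ι ≃ κ) (τ' : ι ≃ μ), ∀ k, (k = z ∨ P k (σ k) (τ k)) → P k (σ' k) (τ' k) := by
  classical
  let c : Equiv.Perm ι := (Equiv.swap z i).trans (Equiv.swap z j)
  refine ⟨c.trans σ, c.symm.trans τ, fun k hk => ?_⟩
  by_cases hkz : k = z
  · subst hkz; simpa [c, Equiv.swap_apply_def, hi, hj, hij.symm, hij] using hz
  by_cases hki : k = i
  · subst hki; simpa [c, Equiv.swap_apply_def, hi, hj, hij.symm, hij] using hPi
  by_cases hkj : k = j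
  · subst hkj; simpa [c, Equiv.swap_apply_def, hi, hj, hij.symm, hij] using hPj
  simpa [c, Equiv.swap_apply_def, hkz, hki, hkj] using hk

variable [Fintype ι]

open scoped Classical in
theorem exists_pair_of_card_filter_not_le {Q₁ Q₂ Q₃ : ι × ι → Prop} (z : ι)
    (h₁ : #{p | ¬Q₁ p} ≤ K) (h₂ : #{p | ¬Q₂ p} ≤ K) (h₃ : #{p | ¬Q₃ p} ≤ K)
    (hK : 3 * K < (Fintype.card ι - 1) * (Fintype.card ι - 2)) :
    ∃ i j, i ≠ z ∧ j ≠ z ∧ i ≠ j ∧ Q₁ (i, j) ∧ Q₂ (i, j) ∧ Q₃ (i, j) := by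
  have hpairs : #((univ : Finset ι).erase z).offDiag =
      (Fintype.card ι - 1) * (Fintype.card ι - 2) := by
    rw [offDiag_card, card_erase_of_mem (mem_univ z), card_univ, ← Nat.mul_sub_one, Nat.sub_sub]
  have hbad : #(({p | ¬Q₁ p} : Finset (ι × ι)) ∪ ({p | ¬Q₂ p} : Finset (ι × ι)) ∪
      ({p | ¬Q₃ p} : Finset (ι × ι))) ≤ 3 * K := by
    grw [card_union_le, card_union_le, h₁, h₂, h₃]
    omega
  obtain ⟨⟨i, j⟩, hij, hgood⟩ :=
    exists_mem_notMem_of_card_lt_card (hbad.trans_lt (hK.trans_eq hpairs.symm))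
  simp only [mem_offDiag, mem_erase, mem_univ, and_true, mem_union, mem_filter, true_and, not_or,
    not_not] at hij hgood
  exact ⟨i, j, hij.1, hij.2.1, hij.2.2, hgood.1.1, hgood.1.2, hgood.2⟩

open scoped Classical in
theorem exists_equiv_forall_rel [Fintype κ] [Fintype μ] {P : ι → κ → μ → Prop}
    (hκ : Fintype.card ι = Fintype.card κ) (hμ : Fintype.card ι = Fintype.card μ)
    (h₁ : ∀ x, #{q : κ × μ | ¬P x q.1 q.2} ≤ K) (h₂ : ∀ y, #{q : ι × μ | ¬P q.1 y q.2} ≤ K)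
    (h₃ : ∀ z, #{q : ι × κ | ¬P q.1 q.2 z} ≤ K)
    (hK : 3 * K < (Fintype.card ι - 1) * (Fintype.card ι - 2)) :
    ∃ (σ : ι ≃ κ) (τ : ι ≃ μ), ∀ k, P k (σ k) (τ k) := by
  have : Nonempty ((ι ≃ κ) × (ι ≃ μ)) :=
    ⟨Fintype.equivOfCardEq hκ, Fintype.equivOfCardEq hμ⟩
  obtain ⟨⟨σ, τ⟩, hmax⟩ := Finite.exists_max
    fun s : (ι ≃ κ) × (ι ≃ μ) => #{k | P k (s.1 k) (s.2 k)}
  refine ⟨σ, τ, ?_⟩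
  by_contra! ⟨z, hz⟩
  obtain ⟨i, j, hi, hj, hij, hPz, hPj, hPi⟩ := exists_pair_of_card_filter_not_le z
    (Q₁ := fun p => P z (σ p.1) (τ p.2)) (Q₂ := fun p => P p.2 (σ z) (τ p.1))
    (Q₃ := fun p => P p.1 (σ p.2) (τ z))
    ((card_equiv (σ.prodCongr τ) (by simp)).trans_le (h₁ z))
    ((card_equiv ((Equiv.prodComm ι ι).trans ((Equiv.refl ι).prodCongr τ)) (by simp)).trans_le
      (h₂ (σ z)))
    ((card_equiv ((Equiv.refl ι).prodCongr σ) (by simp)).trans_le (h₃ (τ z))) hK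
  obtain ⟨σ', τ', h'⟩ := exists_equiv_rel_insert σ τ hi hj hij hPz hPj hPi
  refine (hmax (σ', τ')).not_gt (card_lt_card (ssubset_iff.2 ⟨z, by simpa using hz, ?_⟩))
  intro k hk
  simpa using h' k (by simpa using hk)

end ThreeDimensional

theorem transversal_inj {A B C : Finset α} (hAB : Disjoint A B) (hAC : Disjoint A C)
    (hBC : Disjoint B C) {a a' b b' c c' : α} (ha : a ∈ A) (hb : b ∈ B) (hc : c ∈ C)
    (ha' : a' ∈ A) (hb' : b' ∈ B) (hc' : c' ∈ C) (h : ({a, b, c} : Finset α) = {a', b', c'}) :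
    a = a' ∧ b = b' ∧ c = c' := by
  have hab {x y} (hx : x ∈ A) (hy : y ∈ B) : x ≠ y := disjoint_iff_ne.1 hAB x hx y hy
  have hac {x y} (hx : x ∈ A) (hy : y ∈ C) : x ≠ y := disjoint_iff_ne.1 hAC x hx y hy
  have hbc {x y} (hx : x ∈ B) (hy : y ∈ C) : x ≠ y := disjoint_iff_ne.1 hBC x hx y hy
  have hma : a ∈ ({a', b', c'} : Finset α) := h ▸ by simp
  have hmb : b ∈ ({a', b', c'} : Finset α) := h ▸ by simp
  have hmc : c ∈ ({a', b', c'} : Finset α) := h ▸ by simp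
  simp only [mem_insert, mem_singleton] at hma hmb hmc
  refine ⟨?_, ?_, ?_⟩
  · simpa only [hab ha hb', hac ha hc', or_false] using hma
  · simpa only [(hab ha' hb).symm, hbc hb hc', or_false, false_or] using hmb
  · simpa only [(hac ha' hc).symm, (hbc hb' hc).symm, false_or] using hmc

theorem exists_equiv_forall_transversal_mem {𝒯 : Finset (Finset α)} {A B C : Finset α} {K : ℕ}
    (hAB : Disjoint A B) (hAC : Disjoint A C) (hBC : Disjoint B C) (hB : #A = #B) (hC : #A = #C)
    (h𝒯 : ∀ a ∈ A, ∀ b ∈ B, ∀ c ∈ C, {a, b, c} ∈ 𝒯)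
    (hdeg : ∀ x ∈ A ∪ B ∪ C, degree (𝒯 \ F) x ≤ K) (hK : 3 * K < (#A - 1) * (#A - 2)) :
    ∃ (σ : A ≃ B) (τ : A ≃ C), ∀ a : A, {(a : α), (σ a : α), (τ a : α)} ∈ F := by
  let t (a : A) (b : B) (c : C) : Finset α := {(a : α), (b : α), (c : α)}
  have ht𝒯 (a b c) : t a b c ∈ 𝒯 := h𝒯 a a.2 b b.2 c c.2
  have ht {a a' b b' c c'} (h : t a b c = t a' b' c') : a = a' ∧ b = b' ∧ c = c' := by
    simpa only [Subtype.ext_iff] using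
      transversal_inj hAB hAC hBC a.2 b.2 c.2 a'.2 b'.2 c'.2 h
  have hbad {β : Type _} [Fintype β] {f : β → Finset α} {x : α} (hx : x ∈ A ∪ B ∪ C)
      (hf : Function.Injective f) (hf𝒯 : ∀ p, f p ∈ 𝒯) (hfx : ∀ p, x ∈ f p) :
      #{p | f p ∉ F} ≤ K :=
    (card_filter_notMem_le_degree_sdiff hf.injOn (fun p _ => hf𝒯 p) fun p _ => hfx p).trans
      (hdeg x hx)
  refine exists_equiv_forall_rel (P := fun a b c => t a b c ∈ F) (K := K) (by simpa using hB)
    (by simpa using hC) (fun a => ?_) (fun b => ?_) (fun c => ?_) (by simpa using hK)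
  · convert hbad (f := fun q : B × C => t a q.1 q.2) (x := a) (by simp)
      (fun p q hpq => Prod.ext (ht hpq).2.1 (ht hpq).2.2) (fun _ => ht𝒯 _ _ _) (by simp [t])
  · convert hbad (f := fun q : A × C => t q.1 b q.2) (x := b) (by simp)
      (fun p q hpq => Prod.ext (ht hpq).1 (ht hpq).2.2) (fun _ => ht𝒯 _ _ _) (by simp [t])
  · convert hbad (f := fun q : A × B => t q.1 q.2 c) (x := c) (by simp)
      (fun p q hpq => Prod.ext (ht hpq).1 (ht hpq).2.1) (fun _ => ht𝒯 _ _ _) (by simp [t])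

theorem exists_perfect_matching_of_degree_sdiff_le {𝒯 : Finset (Finset α)} {A B C : Finset α}
    {K : ℕ} (hAB : Disjoint A B) (hAC : Disjoint A C) (hBC : Disjoint B C) (hB : #A = #B)
    (hC : #A = #C) (h𝒯 : ∀ a ∈ A, ∀ b ∈ B, ∀ c ∈ C, {a, b, c} ∈ 𝒯)
    (hdeg : ∀ x ∈ A ∪ B ∪ C, degree (𝒯 \ F) x ≤ K) (hK : 3 * K < (#A - 1) * (#A - 2)) :
    ∃ M, IsTripleMatching F (A ∪ B ∪ C) M ∧ #M = #A := by
  obtain ⟨σ, τ, h⟩ := exists_equiv_forall_transversal_mem hAB hAC hBC hB hC h𝒯 hdeg hK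
  have hab (a : A) (b : B) : (a : α) ≠ b := disjoint_iff_ne.1 hAB a a.2 b b.2
  have hac (a : A) (c : C) : (a : α) ≠ c := disjoint_iff_ne.1 hAC a a.2 c c.2
  have hbc (b : B) (c : C) : (b : α) ≠ c := disjoint_iff_ne.1 hBC b b.2 c c.2
  rw [← Fintype.card_coe A]
  refine IsTripleMatching.exists_card_eq_fintypeCard h (fun a => mem_powersetCard.2
    ⟨by simp [insert_subset_iff], card_eq_three.2 ⟨_, _, _, hab _ _, hac _ _, hbc _ _, rfl⟩⟩)
    fun k l hkl => ?_
  simp [hkl.symm, hab, hac, hbc, (hab _ _).symm, (hac _ _).symm, (hbc _ _).symm]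

/-! ### Matchings of crossing triples -/

/-- The triples contained in `V ∪ W` that meet both `V` and `W`. For disjoint `V` and `W` these are
the edges of `H_{n,d}(V, W)`, where `n = #(V ∪ W)` and `d = #W`. -/
def crossing (V W : Finset α) : Finset (Finset α) :=
  {e ∈ (V ∪ W).powersetCard 3 | ¬Disjoint e V ∧ ¬Disjoint e W}

theorem crossing_mono {V' W' : Finset α} (hV : V ⊆ V') (hW : W ⊆ W') :
    crossing V W ⊆ crossing V' W' := fun _ he => by
  simp only [crossing, mem_filter] at he ⊢
  exact ⟨powersetCard_mono (union_subset_union hV hW) he.1,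
    fun h => he.2.1 (h.mono_right hV), fun h => he.2.2 (h.mono_right hW)⟩

theorem degree_crossing_sdiff_le (S : Finset α) (v : α) :
    degree (crossing (V \ S) (W \ S) \ F) v ≤ degree (crossing V W \ F) v :=
  degree_mono (sdiff_subset_sdiff (crossing_mono sdiff_subset sdiff_subset) Subset.rfl) v

theorem insert_mem_crossing {p : Finset α} (hVW : Disjoint V W) (hv : v ∈ V)
    (hp : p ∈ W.powersetCard 2) : insert v p ∈ crossing V W := by
  obtain ⟨hpW, hp2⟩ := mem_powersetCard.1 hp
  obtain ⟨w, hw⟩ : p.Nonempty := card_pos.1 (by omega)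
  refine mem_filter.2 ⟨mem_powersetCard.2 ⟨insert_subset (mem_union_left W hv)
    (hpW.trans subset_union_right), ?_⟩, not_disjoint_iff.2 ⟨v, mem_insert_self v p, hv⟩,
    not_disjoint_iff.2 ⟨w, mem_insert_of_mem hw, hpW hw⟩⟩
  rw [card_insert_of_notMem fun h => disjoint_left.1 hVW hv (hpW h), hp2]

theorem triple_mem_crossing {x y z : α} (hVW : Disjoint V W) (hx : x ∈ V) (hy : y ∈ V)
    (hz : z ∈ W) (hxy : x ≠ y) : {x, y, z} ∈ crossing V W := by
  refine mem_filter.2 ⟨mem_powersetCard.2 ⟨by simp [insert_subset_iff, hx, hy, hz],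
    card_eq_three.2 ⟨x, y, z, hxy, disjoint_iff_ne.1 hVW x hx z hz,
      disjoint_iff_ne.1 hVW y hy z hz, rfl⟩⟩, not_disjoint_iff.2 ⟨x, by simp, hx⟩,
    not_disjoint_iff.2 ⟨z, by simp, hz⟩⟩

theorem exists_mem_inter_card_of_degree_lt {a : ℕ} {S : Finset α} (hVW : Disjoint V W)
    (hv : v ∈ V) (hvS : v ∉ S) (hdeg : degree (crossing V W \ F) v < a.choose 2)
    (ha : a ≤ #(W \ S)) :
    ∃ e ∈ F, e ∈ (V ∪ W).powersetCard 3 ∧ Disjoint S e ∧ #(e ∩ V) = 1 ∧ #(e ∩ W) = 2 := by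
  have hvW : v ∉ W := disjoint_left.1 hVW hv
  have hcross : ∀ p ∈ (W \ S).powersetCard 2, insert v p ∈ crossing V W := fun p hp =>
    insert_mem_crossing hVW hv (powersetCard_mono sdiff_subset hp)
  obtain ⟨p, hp, hpF⟩ := exists_insert_mem_of_degree_sdiff_lt
    (fun p hp hvp => hvW (sdiff_subset ((mem_powersetCard.1 hp).1 hvp))) hcross
    (hdeg.trans_le (by rw [card_powersetCard]; exact Nat.choose_le_choose 2 ha))
  obtain ⟨hpWS, hp2⟩ := mem_powersetCard.1 hp
  have hpW := hpWS.trans sdiff_subset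
  refine ⟨insert v p, hpF, (mem_filter.1 (hcross p hp)).1, disjoint_insert_right.2
    ⟨hvS, disjoint_of_subset_right hpWS disjoint_sdiff⟩, ?_, ?_⟩
  · rw [insert_inter_of_mem hv, disjoint_iff_inter_eq_empty.1 (hVW.symm.mono_left hpW),
      card_insert_of_notMem (notMem_empty v), card_empty]
  · rw [insert_inter_of_notMem hvW, inter_eq_left.2 hpW, hp2]

theorem exists_matching_inter_card {a : ℕ} (hVW : Disjoint V W)
    (hdeg : ∀ v ∈ V, degree (crossing V W \ F) v < a.choose 2) (j : ℕ) (hV : j ≤ #V)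
    (hW : a + 2 * j ≤ #W) :
    ∃ M, IsTripleMatching F (V ∪ W) M ∧ #M = j ∧ ∀ e ∈ M, #(e ∩ V) = 1 ∧ #(e ∩ W) = 2 := by
  induction j with
  | zero => exact ⟨∅, .empty F _, by simp⟩
  | succ j ih =>
    obtain ⟨M, hM, hMj, hMtype⟩ := ih (by omega) (by omega)
    have hMV := hM.card_biUnion_inter fun e he => (hMtype e he).1
    have hMW := hM.card_biUnion_inter fun e he => (hMtype e he).2
    obtain ⟨v, hv, hvM⟩ : ∃ v ∈ V, v ∉ M.biUnion id := by
      by_contra! h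
      rw [inter_eq_right.2 h] at hMV
      omega
    obtain ⟨e, heF, heX, hd, hetype⟩ := exists_mem_inter_card_of_degree_lt hVW hv hvM
      (hdeg v hv) (by rw [card_sdiff, hMW]; omega)
    refine ⟨insert e M, hM.insert heF heX hd, ?_, ?_⟩
    · rw [card_insert_of_disjoint_biUnion heX hd, hMj]
    · simpa only [forall_mem_insert] using ⟨hetype, hMtype⟩

theorem exists_matching_of_two_mul_le {m K : ℕ} (hVW : Disjoint V W)
    (hdeg : ∀ x ∈ V ∪ W, degree (crossing V W \ F) x ≤ K) (hV : 2 * m ≤ #V) (hW : m ≤ #W)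
    (hK : 3 * K < (m - 1) * (m - 2)) :
    ∃ M, IsTripleMatching F (V ∪ W) M ∧ #M = m := by
  obtain ⟨A, hAV, rfl⟩ := exists_subset_card_eq (by omega : m ≤ #V)
  obtain ⟨B, hBsub, hB⟩ := exists_subset_card_eq (s := V \ A) (n := #A)
    (by rw [card_sdiff_of_subset hAV]; omega)
  obtain ⟨C, hCW, hC⟩ := exists_subset_card_eq hW
  have hBV := hBsub.trans sdiff_subset
  have hsub : A ∪ B ∪ C ⊆ V ∪ W := union_subset_union (union_subset hAV hBV) hCW
  have hAB : Disjoint A B := disjoint_of_subset_right hBsub disjoint_sdiff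
  obtain ⟨M, hM, hMA⟩ := exists_perfect_matching_of_degree_sdiff_le hAB (hVW.mono hAV hCW)
    (hVW.mono hBV hCW) hB.symm hC.symm
    (fun x hx y hy z hz => triple_mem_crossing hVW (hAV hx) (hBV hy) (hCW hz)
      (disjoint_iff_ne.1 hAB x hx y hy))
    (fun x hx => hdeg x (hsub hx)) hK
  exact ⟨M, hM.mono hsub, hMA⟩

theorem lt_choose_two_of_three_mul_lt {a K : ℕ} (hK : 3 * K < (a - 1) * (a - 2)) :
    K < a.choose 2 := by
  have hpairs : 2 * (a - 1).choose 2 = (a - 1) * (a - 2) := by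
    rw [Nat.choose_two_right, Nat.mul_div_cancel' (Nat.even_mul_pred_self _).two_dvd, Nat.sub_sub]
  have := Nat.choose_le_choose 2 (Nat.sub_le a 1)
  omega

theorem exists_matching_of_three_mul_le {m a K : ℕ} (hVW : Disjoint V W)
    (hdeg : ∀ x ∈ V ∪ W, degree (crossing V W \ F) x ≤ K) (hWm : m ≤ #W)
    (hm : 3 * m ≤ #V + #W) (ham : a ≤ m) (haV : a + m ≤ #V) (hK : 3 * K < (a - 1) * (a - 2)) :
    ∃ M, IsTripleMatching F (V ∪ W) M ∧ #M = m := by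
  -- `2 * m - #V` triples with two vertices in `W` make up for the shortage of vertices in `V`.
  obtain ⟨M, hM, hMj, hMtype⟩ := exists_matching_inter_card (F := F) (a := a) hVW
    (fun v hv => (hdeg v (mem_union_left W hv)).trans_lt (lt_choose_two_of_three_mul_lt hK))
    (2 * m - #V) (by omega) (by omega)
  have hMV := hM.card_biUnion_inter fun e he => (hMtype e he).1
  have hMW := hM.card_biUnion_inter fun e he => (hMtype e he).2
  have hN : ∃ N, IsTripleMatching F ((V ∪ W) \ M.biUnion id) N ∧ #N = m - #M := by
    rw [union_sdiff_distrib]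
    refine exists_matching_of_two_mul_le (K := K) (hVW.mono sdiff_subset sdiff_subset)
      (fun x hx => ?_) (by rw [card_sdiff, hMV]; omega) (by rw [card_sdiff, hMW]; omega)
      (hK.trans_le (Nat.mul_le_mul (by omega) (by omega)))
    rw [← union_sdiff_distrib] at hx
    exact (degree_crossing_sdiff_le _ x).trans (hdeg x (sdiff_subset hx))
  rw [show m = #M + (m - #M) by omega]
  exact hM.exists_card_eq_add hN

/-! ### Covering the atypical vertices -/

theorem exists_mem_disjoint_inter_card_le_one {S G : Finset α} {x : α} {y : ℕ} (hxX : x ∈ X)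
    (hxS : x ∉ S) (hxG : x ∉ G) (hy : y + #S + 1 ≤ #X)
    (hdeg : degree (X.powersetCard 3 \ F) x + (#G).choose 2 < y.choose 2) :
    ∃ e ∈ F, e ∈ X.powersetCard 3 ∧ x ∈ e ∧ Disjoint S e ∧ #(e ∩ G) ≤ 1 := by
  set Y := X.erase x \ S
  have hYc : y ≤ #Y := by
    have hle : #(X.erase x) - #S ≤ #Y := le_card_sdiff S (X.erase x)
    rw [card_erase_of_mem hxX] at hle
    omega
  have hxY : x ∉ Y := fun h => notMem_erase x X (sdiff_subset h)
  have hpair : ∀ p ∈ Y.powersetCard 2 \ G.powersetCard 2, p ⊆ Y ∧ #p = 2 := fun p hp =>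
    mem_powersetCard.1 (sdiff_subset hp)
  have hcard : ∀ p ∈ Y.powersetCard 2 \ G.powersetCard 2, insert x p ∈ X.powersetCard 3 :=
    fun p hp => mem_powersetCard.2 ⟨insert_subset hxX
      ((hpair p hp).1.trans (sdiff_subset.trans (erase_subset x X))),
      by rw [card_insert_of_notMem fun h => hxY ((hpair p hp).1 h), (hpair p hp).2]⟩
  obtain ⟨p, hp, hpF⟩ := exists_insert_mem_of_degree_sdiff_lt (F := F)
    (fun p hp h => hxY ((hpair p hp).1 h)) hcard (by
      have hsdiff := le_card_sdiff (G.powersetCard 2) (Y.powersetCard 2)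
      have hchoose := Nat.choose_le_choose 2 hYc
      simp only [card_powersetCard] at hsdiff
      omega)
  refine ⟨insert x p, hpF, hcard p hp, mem_insert_self x p, disjoint_insert_right.2
    ⟨hxS, disjoint_of_subset_right (hpair p hp).1 disjoint_sdiff⟩, ?_⟩
  have hpG : ¬p ⊆ G := fun h =>
    (mem_sdiff.1 hp).2 (mem_powersetCard.2 ⟨h, (hpair p hp).2⟩)
  have hlt : #(p ∩ G) < #p := card_lt_card
    (inter_subset_left.ssubset_of_not_subset fun h => hpG (h.trans inter_subset_right))
  rw [(hpair p hp).2] at hlt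
  rw [insert_inter_of_notMem hxG]
  exact Nat.le_of_lt_succ hlt

theorem exists_matching_cover {G B : Finset α} {b : ℕ} (hM : IsTripleMatching F X M)
    (hBX : B ⊆ X) (hBG : Disjoint B G) (hb : #M + #B ≤ b)
    (hdeg : ∀ x ∈ B,
      degree (X.powersetCard 3 \ F) x + (#G).choose 2 < (#X - (3 * b + 1)).choose 2) :
    ∃ N, IsTripleMatching F X N ∧ B ⊆ N.biUnion id ∧ #N ≤ #M + #B ∧
      #(N.biUnion id ∩ G) + #M ≤ #N + #(M.biUnion id ∩ G) := by
  induction B using Finset.induction_on with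
  | empty => exact ⟨M, hM, empty_subset _, le_rfl, (add_comm _ _).le⟩
  | insert x B hxB ih =>
    rw [card_insert_of_notMem hxB] at hb ⊢
    obtain ⟨hxX, hBX⟩ := insert_subset_iff.1 hBX
    obtain ⟨hxG, hBG⟩ := disjoint_insert_left.1 hBG
    obtain ⟨N, hN, hBN, hNc, hNG⟩ := ih hBX hBG (by omega)
      fun y hy => hdeg y (mem_insert_of_mem hy)
    by_cases hxN : x ∈ N.biUnion id
    · exact ⟨N, hN, insert_subset hxN hBN, by omega, hNG⟩
    have hpos : 0 < (#X - (3 * b + 1)).choose 2 := (Nat.zero_le _).trans_lt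
      (hdeg x (mem_insert_self x B))
    have hy : #X - (3 * b + 1) ≠ 0 := fun h => by simp [h] at hpos
    obtain ⟨e, heF, heX, hxe, hd, heG⟩ := exists_mem_disjoint_inter_card_le_one hxX hxN hxG
      (by rw [hN.card_biUnion]; omega) (hdeg x (mem_insert_self x B))
    have hunion : (insert e N).biUnion id = e ∪ N.biUnion id := biUnion_insert
    refine ⟨insert e N, hN.insert heF heX hd, ?_, ?_, ?_⟩
    · rw [hunion]
      exact insert_subset (mem_union_left _ hxe) (hBN.trans subset_union_right)
    · rw [card_insert_of_disjoint_biUnion heX hd]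
      omega
    · rw [card_insert_of_disjoint_biUnion heX hd, hunion, union_inter_distrib_right]
      have := card_union_le (e ∩ G) (N.biUnion id ∩ G)
      omega

theorem choose_two_add_choose_two_le {v w g b : ℕ} (hwv : 2 * w ≤ v) (hvw : v ≤ 99 * w)
    (hn : 1000 ≤ v + w) (hb : 5000 * b ≤ v + w) (hg : g ≤ w) :
    v.choose 2 + g.choose 2 ≤ (v + w - (3 * b + 1)).choose 2 := by
  obtain ⟨y, hy⟩ : ∃ y, v + w = y + (3 * b + 1) := ⟨v + w - (3 * b + 1), by omega⟩
  have hv := choose_two_add v w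
  have hsplit := choose_two_add y (3 * b + 1)
  have hgw := Nat.choose_le_choose 2 hg
  have hc : (3 * b + 1).choose 2 ≤ (3 * b + 1) * (3 * b + 1) := by
    rw [← sq]; exact Nat.choose_le_pow _ _
  have hprod : y * (3 * b + 1) + (3 * b + 1) * (3 * b + 1) ≤ v * w := by
    nlinarith
  rw [hy] at hv ⊢
  rw [Nat.add_sub_cancel]
  omega

/-- First match the atypical vertices of `W` inside `V ∪ (B ∩ W)`; the later triples each use at
most one of the typical vertices of `W`, so `W` loses at most as many vertices as there are
triples. -/
theorem exists_matching_cover_atypical {B : Finset α} (hVW : Disjoint V W) (hwv : 2 * #W ≤ #V)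
    (hvw : #V ≤ 99 * #W) (hn : 1000 ≤ #V + #W) (hBX : B ⊆ V ∪ W) (hB : 10000 * #B ≤ #V + #W)
    (hdeg : ∀ x ∈ V ∪ W, degree ((V ∪ W).powersetCard 3 \ F) x < (#V).choose 2) :
    ∃ M, IsTripleMatching F (V ∪ W) M ∧ B ⊆ M.biUnion id ∧ #M ≤ 2 * #B ∧
      #W ≤ #(W \ M.biUnion id) + #M := by
  have hBW : #(B ∩ W) ≤ #B := card_le_card inter_subset_left
  have hsub : V ∪ (B ∩ W) ⊆ V ∪ W := union_subset_union_right inter_subset_right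
  have hX : #(V ∪ (B ∩ W)) = #V + #(B ∩ W) :=
    card_union_of_disjoint (hVW.mono_right inter_subset_right)
  obtain ⟨M, hM, hMc⟩ := exists_matching_of_degree_sdiff_lt F #(B ∩ W) (V ∪ (B ∩ W)) (by omega)
    fun x hx => by
      rw [hX, Nat.add_sub_cancel]
      exact (degree_mono (sdiff_subset_sdiff (powersetCard_mono hsub) Subset.rfl) x).trans_lt
        (hdeg x (hsub hx))
  have hMG : #(M.biUnion id ∩ (W \ B)) = 0 := by
    rw [card_eq_zero, ← disjoint_iff_inter_eq_empty]
    refine disjoint_of_subset_left hM.biUnion_subset (disjoint_union_left.2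
      ⟨hVW.mono_right sdiff_subset, ?_⟩)
    exact disjoint_of_subset_left inter_subset_left disjoint_sdiff
  obtain ⟨N, hN, hBN, hNc, hNG⟩ := exists_matching_cover (G := W \ B) (b := 2 * #B)
    (hM.mono hsub) hBX disjoint_sdiff (by omega) fun x hx => by
      rw [card_union_of_disjoint hVW]
      exact (Nat.add_lt_add_right (hdeg x (hBX hx)) _).trans_le (choose_two_add_choose_two_le
        hwv hvw hn (by omega) (card_le_card sdiff_subset))
  refine ⟨N, hN, hBN, by omega, ?_⟩
  have hloss : #(W \ B) - #(N.biUnion id ∩ (W \ B)) ≤ #(W \ N.biUnion id) := by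
    rw [← card_sdiff]
    exact card_le_card (sdiff_subset_sdiff sdiff_subset Subset.rfl)
  have hWB : #(W \ B) = #W - #(B ∩ W) := card_sdiff
  omega

/-! ### Matchings in near-extremal families -/

theorem card_filter_lt_degree_le {𝒢 : Finset (Finset α)} {n : ℕ}
    (h𝒢 : (𝒢 : Set (Finset α)).Sized 3) (hn : 0 < n) (hcard : 10 ^ 12 * #𝒢 ≤ n ^ 3) :
    10 ^ 6 * #{x ∈ X | n ^ 2 / 10 ^ 6 < degree 𝒢 x} ≤ 3 * n := by
  set B := {x ∈ X | n ^ 2 / 10 ^ 6 < degree 𝒢 x}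
  have hB : #B * (n ^ 2 / 10 ^ 6 + 1) ≤ 3 * #𝒢 :=
    card_mul_le_mul_card_of_le_degree h𝒢 fun x hx => (mem_filter.1 hx).2
  refine Nat.le_of_mul_le_mul_right (c := n ^ 2) ?_ (by positivity)
  calc 10 ^ 6 * #B * n ^ 2 ≤ 10 ^ 6 * #B * (10 ^ 6 * (n ^ 2 / 10 ^ 6 + 1)) :=
        Nat.mul_le_mul_left _ (by omega)
    _ = 10 ^ 12 * (#B * (n ^ 2 / 10 ^ 6 + 1)) := by ring
    _ ≤ 10 ^ 12 * (3 * #𝒢) := Nat.mul_le_mul_left _ hB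
    _ ≤ 3 * n ^ 3 := by omega
    _ = 3 * n * n ^ 2 := by ring

theorem three_mul_sq_div_lt {n : ℕ} (hn : 10 ^ 6 ≤ n) :
    3 * (n ^ 2 / 10 ^ 6) < (n / 200 - 1) * (n / 200 - 2) := by
  obtain ⟨a, ha⟩ : ∃ a, n / 200 = a + 2 := ⟨n / 200 - 2, by omega⟩
  have hna : n ^ 2 ≤ (400 * a) ^ 2 := Nat.pow_le_pow_left (by omega) 2
  have hK : 10 ^ 6 * (n ^ 2 / 10 ^ 6) ≤ n ^ 2 := Nat.mul_div_le _ _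
  have ha0 : 0 < a := by omega
  rw [ha, Nat.add_sub_cancel, show a + 2 - 1 = a + 1 by omega]
  nlinarith

theorem exists_matching_of_card_crossing_sdiff_le {n : ℕ} (hVW : Disjoint V W)
    (hn : #V + #W = n) (hn₀ : 10 ^ 6 ≤ n) (hwv : 2 * #W ≤ #V)
    (hdeg : ∀ x ∈ V ∪ W, degree ((V ∪ W).powersetCard 3 \ F) x < (#V).choose 2)
    (hclose : 10 ^ 12 * #(crossing V W \ F) ≤ n ^ 3) :
    ∃ M, IsTripleMatching F (V ∪ W) M ∧ #M = #W := by
  have hX : #(V ∪ W) = #V + #W := card_union_of_disjoint hVW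
  rcases le_total (100 * #W) n with hsmall | hlarge
  · exact exists_matching_of_degree_sdiff_lt F #W (V ∪ W) (by omega)
      (by rwa [hX, Nat.add_sub_cancel])
  set K := n ^ 2 / 10 ^ 6
  set B := {x ∈ V ∪ W | K < degree (crossing V W \ F) x}
  have hB : 10 ^ 6 * #B ≤ 3 * n := card_filter_lt_degree_le
    (fun e he => (mem_powersetCard.1 (mem_filter.1 (mem_sdiff.1 he).1).1).2) (by omega) hclose
  obtain ⟨M, hM, hBM, hMB, hWM⟩ := exists_matching_cover_atypical (B := B) hVW hwv (by omega)
    (by omega) (filter_subset _ _) (by omega) hdeg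
  set S := M.biUnion id
  have hS : #S = 3 * #M := hM.card_biUnion
  have hVS : #V - #S ≤ #(V \ S) := le_card_sdiff S V
  have hd : Disjoint (V \ S) (W \ S) := hVW.mono sdiff_subset sdiff_subset
  have hVWS : #(V \ S) + #(W \ S) = n - 3 * #M := by
    rw [← card_union_of_disjoint hd, ← union_sdiff_distrib,
      card_sdiff_of_subset hM.biUnion_subset, hX, hn, hS]
  have hN : ∃ N, IsTripleMatching F ((V ∪ W) \ S) N ∧ #N = #W - #M := by
    rw [union_sdiff_distrib]
    refine exists_matching_of_three_mul_le (a := n / 200) (K := K) hd (fun x hx => ?_) (by omega)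
      (by omega) (by omega) (by omega) (three_mul_sq_div_lt hn₀)
    rw [← union_sdiff_distrib] at hx
    obtain ⟨hxX, hxS⟩ := mem_sdiff.1 hx
    exact (degree_crossing_sdiff_le S x).trans
      (not_lt.1 fun hlt => hxS (hBM (mem_filter.2 ⟨hxX, hlt⟩)))
  rw [show #W = #M + (#W - #M) by omega]
  exact hM.exists_card_eq_add hN

/-! ### Hypergraphs as families of finite sets -/

theorem vertexDegree_le_degree_edgeTriples (hH : H.IsThreeUniform)
    (hX : (X : Set α) = H.vertexSet) (v : α) :
    H.vertexDegree v ≤ degree (edgeTriples H X) v := by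
  rw [degree, ← Set.ncard_coe_finset, ← Set.ncard_image_of_injective _ coe_injective]
  refine Set.ncard_le_ncard ?_ ((finite_toSet _).image _)
  rintro e ⟨he, hve⟩
  have heX : e ⊆ X := hX ▸ H.subset_vertexSet_of_mem_edgeSet he
  lift e to Finset α using X.finite_toSet.subset heX
  have he3 : #e = 3 := by simpa using hH e he
  exact ⟨e, mem_filter.2 ⟨mem_edgeTriples.2 ⟨mem_powersetCard.2 ⟨coe_subset.1 heX, he3⟩, he⟩, hve⟩,
    rfl⟩

theorem degree_sdiff_edgeTriples_lt {k : ℕ} (hH : H.IsThreeUniform)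
    (hX : (X : Set α) = H.vertexSet) (hv : v ∈ X)
    (hdeg : ((#X - 1).choose 2 : ℤ) - (k.choose 2 : ℤ) < H.minVertexDegree) :
    degree (X.powersetCard 3 \ edgeTriples H X) v < k.choose 2 := by
  have hmin : H.minVertexDegree ≤ H.vertexDegree v := Nat.sInf_le ⟨v, hX ▸ hv, rfl⟩
  have hle := vertexDegree_le_degree_edgeTriples hH hX v
  have hsum := degree_inter_add_degree_sdiff (X.powersetCard 3) (edgeTriples H X) v
  rw [degree_powersetCard hv, inter_eq_right.2 edgeTriples_subset] at hsum
  omega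

theorem coe_mem_edgeSet_extremal (hVW : Disjoint V W) (he : e ∈ crossing V W) :
    (e : Set α) ∈ (Hypergraph.extremal (V : Set α) W).edgeSet := by
  obtain ⟨heX, heV, heW⟩ := mem_filter.1 he
  obtain ⟨heX, he3⟩ := mem_powersetCard.1 heX
  obtain ⟨x, hxe, hx⟩ := not_disjoint_iff.1 heV
  obtain ⟨z, hze, hz⟩ := not_disjoint_iff.1 heW
  have hxz : x ≠ z := disjoint_iff_ne.1 hVW x hx z hz
  obtain ⟨y, hye, hy⟩ : ∃ y ∈ e, y ∉ ({x, z} : Finset α) :=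
    exists_mem_notMem_of_card_lt_card (by rw [card_pair hxz, he3]; norm_num)
  simp only [mem_insert, mem_singleton, not_or] at hy
  have hexyz : ({x, y, z} : Finset α) = e := eq_of_subset_of_card_le
    (by simp [insert_subset_iff, hxe, hye, hze])
    (by rw [he3, card_eq_three.2 ⟨x, y, z, Ne.symm hy.1, hxz, hy.2, rfl⟩])
  have hcoe : (e : Set α) = {x, y, z} := by simp [← hexyz]
  rcases mem_union.1 (heX hye) with hyV | hyW
  · exact .inl ⟨x, hx, y, hyV, z, hz, Ne.symm hy.1, hxz, hy.2, hcoe⟩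
  · exact .inr ⟨x, hx, y, hyW, z, hz, Ne.symm hy.1, hxz, hy.2, hcoe⟩

theorem card_crossing_sdiff_edgeTriples_le (hVW : Disjoint V W) :
    #(crossing V W \ edgeTriples H (V ∪ W)) ≤
      ((Hypergraph.extremal (V : Set α) W).edgeSet \ H.edgeSet).ncard := by
  rw [← Set.ncard_coe_finset, ← Set.ncard_image_of_injective _ coe_injective]
  refine Set.ncard_le_ncard ?_ ((V ∪ W).finite_toSet.finite_subsets.subset fun e he => by
    rw [Set.mem_ofPred_eq, coe_union]
    exact (Hypergraph.extremal (V : Set α) W).subset_vertexSet_of_mem_edgeSet he.1)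
  rintro _ ⟨e, he, rfl⟩
  obtain ⟨hcross, hmiss⟩ := mem_sdiff.1 he
  exact ⟨coe_mem_edgeSet_extremal hVW hcross,
    fun heH => hmiss (mem_edgeTriples.2 ⟨(mem_filter.1 hcross).1, heH⟩)⟩

end TripleSystem

open Finset TripleSystem in
theorem lemma4p1 :
    ∃ ε : ℝ, 0 < ε ∧ ∃ n₀ : ℕ,
      ∀ (α : Type*) (H : Hypergraph α) (n d : ℕ),
        H.IsThreeUniform →
        H.vertexSet.Finite → H.vertexSet.ncard = n → n₀ ≤ n →
        (d : ℝ) ≤ (n : ℝ) / 3 →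
        ((n - 1).choose 2 : ℤ) - ((n - d).choose 2 : ℤ) < (H.minVertexDegree : ℤ) →
        H.IsCloseToExtremal ε d →
        H.HasMatchingOfSize d := by
  refine ⟨1 / 10 ^ 12, by positivity, 10 ^ 6, fun α H n d hH hfin hn hn₀ hd hdeg hclose => ?_⟩
  obtain ⟨V, W, hX, hVW, hW, hmiss⟩ := hclose
  classical
  lift V to Finset α using hfin.subset (hX ▸ Set.subset_union_left)
  lift W to Finset α using hfin.subset (hX ▸ Set.subset_union_right)
  rw [disjoint_coe] at hVW
  rw [Set.ncard_coe_finset] at hW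
  rw [← coe_union] at hX
  have hcard : #(V ∪ W) = n := by rw [← hn, ← hX, Set.ncard_coe_finset]
  have hsum : #V + #W = n := by rw [← card_union_of_disjoint hVW, hcard]
  have hdn : 3 * d ≤ n := by
    have : (3 * d : ℝ) ≤ n := by linarith
    exact_mod_cast this
  have hcross : 10 ^ 12 * #(crossing V W \ edgeTriples H (V ∪ W)) ≤ n ^ 3 := by
    have hle : (#(crossing V W \ edgeTriples H (V ∪ W)) : ℝ) ≤ 1 / 10 ^ 12 * n ^ 3 :=
      (Nat.cast_le.2 (card_crossing_sdiff_edgeTriples_le hVW)).trans (hn ▸ hmiss)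
    exact_mod_cast (by linarith : (10 ^ 12 * #(crossing V W \ edgeTriples H (V ∪ W)) : ℝ) ≤ n ^ 3)
  obtain ⟨M, hM, hMW⟩ := exists_matching_of_card_crossing_sdiff_le hVW hsum hn₀ (by omega)
    (fun x hx => degree_sdiff_edgeTriples_lt hH hX hx
      (by rwa [hcard, show #V = n - d by omega])) hcross
  exact hW ▸ hMW ▸ hM.hasMatchingOfSize
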